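/- Let $d>0$, $p\in(0,1]$, $\rho\in[0,1]$ and $W\ge 0$, and put $b^j=dp\,\frac{j(j+1)}{2}$ for $j\in\mathbb N=\{0,1,2,\dots\}$. Consider the Markov decision process with state space $\{b^j:j\ge 0\}$, actions $a\in\{0,1\}$ ($0$ passive, $1$ active), and instantaneous cost $s+Wa$ in state $s$ under action $a$. Under the passive action the state moves from $b^j$ to $b^{j+1}$. Under the active action it moves from $b^j$ to $b^0$ with probability $\rho$ and to $b^{j+1}$ with probability $1-\rho$. A causal policy $\phi$ chooses the action $a(t)$ at each time $t$, possibly at random, from the past states and actions and the current state $s(t)$. Its long-run average cost from the initial state $s(0)$ is $$J^\phi(s(0))=\limsup_{T\to+\infty}\frac1T\,\mathbb E^{\phi}\Big[\sum_{t=0}^{T-1}\big(s(t)+W a(t)\big)\,\Big|\,s(0)\Big]\in[0,\infty].$$ Then there is $n\in\mathbb N$ such that the stationary deterministic policy which is passive in every state $b^j<b^n$ (that is, $j<n$) and active in every state $b^j\ge b^n$ (that is, $j\ge n$) is optimal: from every initial state, it minimizes $J^\phi$ over all causal policies $\phi$. -/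

import Mathlib

open scoped NNReal ENNReal

noncomputable section

namespace AoII

/-- The `j`-th penalty level `b^j = d p j (j + 1) / 2`. For `d, p > 0` the map `j ↦ b^j` is
injective, and the state `b^j` of the decision process is represented by its index `j`. -/
def level (d p : ℝ≥0) (j : ℕ) : ℝ≥0 := d * p * ((j : ℝ≥0) * ((j : ℝ≥0) + 1)) / 2

/-- Actions: `true` is the active action `a = 1`, `false` is the passive action `a = 0`. -/
def actionValue (a : Bool) : ℝ≥0 := if a then 1 else 0

/-- Instantaneous cost `s + W a` in the state `s = b^j`. -/
def cost (d p W : ℝ≥0) (j : ℕ) (a : Bool) : ℝ≥0 := level d p j + W * actionValue a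

/-- Law of the next state. Under the passive action, `b^j` moves to `b^{j+1}`. Under the active
action it moves to `b^0` with probability `ρ` (success) and to `b^{j+1}` with probability
`1 - ρ`. -/
def transition (ρ : ℝ≥0) (hρ : ρ ≤ 1) (j : ℕ) (a : Bool) : PMF ℕ :=
  if a then (PMF.bernoulli ρ hρ).map (fun success => if success then 0 else j + 1)
  else PMF.pure (j + 1)

/-- The pairs (state, action) of all the past time slots, the most recent one first. -/
abbrev History : Type := List (ℕ × Bool)

/-- A causal policy, possibly randomized and history-dependent: from the past and the current
state it gives the law of the current action. The time is the length of the history. -/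
abbrev Policy : Type := History → ℕ → PMF Bool

/-- The stationary deterministic policy that takes the action `f j` in the state `b^j`. -/
def stationary (f : ℕ → Bool) : Policy := fun _ j => PMF.pure (f j)

/-- Joint law of the history before time `t` and of the state at time `t`, under the policy `φ`,
from the initial state `b^{j₀}`. -/
def law (ρ : ℝ≥0) (hρ : ρ ≤ 1) (φ : Policy) (j₀ : ℕ) : ℕ → PMF (History × ℕ)
  | 0 => PMF.pure ([], j₀)
  | t + 1 => (law ρ hρ φ j₀ t).bind fun x =>
      (φ x.1 x.2).bind fun a =>
        (transition ρ hρ x.2 a).map fun j' => ((x.2, a) :: x.1, j')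

/-- Total cost `∑ (s(t) + W a(t))` along a history. -/
def historyCost (d p W : ℝ≥0) (h : History) : ℝ≥0 :=
  (h.map fun x => cost d p W x.1 x.2).sum

/-- Expected total cost over the time slots `0, …, T - 1`, from the initial state `b^{j₀}`. -/
def expectedTotalCost (d p W ρ : ℝ≥0) (hρ : ρ ≤ 1) (φ : Policy) (j₀ T : ℕ) : ℝ≥0∞ :=
  ∑' x : History × ℕ, law ρ hρ φ j₀ T x * (historyCost d p W x.1 : ℝ≥0∞)

/-- Long-run average expected cost (upper limit), with value in `[0, ∞]`. -/
def averageCost (d p W ρ : ℝ≥0) (hρ : ρ ≤ 1) (φ : Policy) (j₀ : ℕ) : ℝ≥0∞ :=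
  Filter.limsup (fun T : ℕ => expectedTotalCost d p W ρ hρ φ j₀ T / (T : ℝ≥0∞)) Filter.atTop

/-- `φ` minimizes the long-run average expected cost among all causal policies, from every
initial state. -/
def IsOptimal (d p W ρ : ℝ≥0) (hρ : ρ ≤ 1) (φ : Policy) : Prop :=
  ∀ (j₀ : ℕ) (ψ : Policy), averageCost d p W ρ hρ φ j₀ ≤ averageCost d p W ρ hρ ψ j₀

/-- `f` is an increasing threshold rule with threshold state `b^n`: it is passive in the states
below `b^n` and active in the others. -/
def IsIncreasingThreshold (d p : ℝ≥0) (n : ℕ) (f : ℕ → Bool) : Prop :=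
  (∀ j, level d p j < level d p n → f j = false) ∧
  (∀ j, level d p n ≤ level d p j → f j = true)

end AoII

end

open scoped NNReal ENNReal

noncomputable section

namespace AoII

/-! For `ρ > 0` the average-cost optimality equation is solved explicitly (`exists_bellman`): the
potential sums `g - b^i` below the threshold and is the always-active value `activeValue` up to a
constant above it. The threshold is where `ρ h` crosses `W`; monotonicity of `h` then makes the
threshold actions minimizing everywhere. Summing the equation along the threshold policy bounds its
cost by `g`, since `h ≥ 0`. For an arbitrary policy the final expected potential must be controlled:
`h` is at most of the order of the level, which is at most the next cost increment. An average below
`g` would make these increments grow linearly, which is absurd (`le_limsup_div_of_increments`). For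
`ρ = 0` every policy costs `⊤`. -/

/-- Expectation of a nonnegative function under a discrete law. -/
def expect {α : Type*} (p : PMF α) (V : α → ℝ≥0∞) : ℝ≥0∞ := ∑' x, p x * V x

theorem expect_pure {α : Type*} (a : α) (V : α → ℝ≥0∞) : expect (PMF.pure a) V = V a := by
  classical
  unfold expect
  rw [tsum_eq_single a (fun b hb => by simp [PMF.pure_apply, hb])]
  simp [PMF.pure_apply]

theorem expect_bind {α β : Type*} (p : PMF α) (f : α → PMF β) (V : β → ℝ≥0∞) :
    expect (p.bind f) V = expect p fun a => expect (f a) V := by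
  unfold expect
  simp only [PMF.bind_apply, ← ENNReal.tsum_mul_right, ← ENNReal.tsum_mul_left]
  rw [ENNReal.tsum_comm]
  simp only [mul_assoc]

theorem expect_map {α β : Type*} (p : PMF α) (f : α → β) (V : β → ℝ≥0∞) :
    expect (p.map f) V = expect p fun a => V (f a) := by
  rw [← PMF.bind_pure_comp, expect_bind]
  simp only [Function.comp_apply, expect_pure]

theorem expect_const {α : Type*} (p : PMF α) (c : ℝ≥0∞) : expect p (fun _ => c) = c := by
  unfold expect
  rw [ENNReal.tsum_mul_right, p.tsum_coe, one_mul]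

theorem expect_add {α : Type*} (p : PMF α) (V U : α → ℝ≥0∞) :
    expect p (fun x => V x + U x) = expect p V + expect p U := by
  simp only [expect, mul_add, ENNReal.tsum_add]

theorem expect_const_mul {α : Type*} (p : PMF α) (c : ℝ≥0∞) (V : α → ℝ≥0∞) :
    expect p (fun x => c * V x) = c * expect p V := by
  simp only [expect, mul_left_comm _ c, ENNReal.tsum_mul_left]

theorem expect_mono {α : Type*} (p : PMF α) {V U : α → ℝ≥0∞} (h : ∀ x, V x ≤ U x) :
    expect p V ≤ expect p U :=
  ENNReal.tsum_le_tsum fun x => mul_le_mul_right (h x) _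

theorem expect_transition_false (ρ : ℝ≥0) (hρ : ρ ≤ 1) (j : ℕ) (V : ℕ → ℝ≥0∞) :
    expect (transition ρ hρ j false) V = V (j + 1) := by
  simp [transition, expect_pure]

theorem expect_transition_true (ρ : ℝ≥0) (hρ : ρ ≤ 1) (j : ℕ) (V : ℕ → ℝ≥0∞) :
    expect (transition ρ hρ j true) V = ρ * V 0 + ((1 - ρ : ℝ≥0) : ℝ≥0∞) * V (j + 1) := by
  simp only [transition, if_true, expect_map]
  simp [expect, PMF.bernoulli_apply]

/-! ### Cost recursion and verification inequalities -/

theorem expect_law_succ (ρ : ℝ≥0) (hρ : ρ ≤ 1) (φ : Policy) (j₀ t : ℕ)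
    (V : History × ℕ → ℝ≥0∞) :
    expect (law ρ hρ φ j₀ (t + 1)) V =
      expect (law ρ hρ φ j₀ t) fun x => expect (φ x.1 x.2) fun a =>
        expect (transition ρ hρ x.2 a) fun j' => V ((x.2, a) :: x.1, j') := by
  simp only [law, expect_bind, expect_map]

theorem historyCost_cons (d p W : ℝ≥0) (j : ℕ) (a : Bool) (h : History) :
    historyCost d p W ((j, a) :: h) = cost d p W j a + historyCost d p W h := by
  simp [historyCost]

theorem expectedTotalCost_eq (d p W ρ : ℝ≥0) (hρ : ρ ≤ 1) (φ : Policy) (j₀ T : ℕ) :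
    expectedTotalCost d p W ρ hρ φ j₀ T =
      expect (law ρ hρ φ j₀ T) fun x => (historyCost d p W x.1 : ℝ≥0∞) := rfl

/-- The slot `T` costs at least its level, whatever the action. The cost itself thus controls the
terminal potential. -/
theorem expectedTotalCost_add_level_le (d p W ρ : ℝ≥0) (hρ : ρ ≤ 1) (φ : Policy) (j₀ T : ℕ) :
    expectedTotalCost d p W ρ hρ φ j₀ T +
        expect (law ρ hρ φ j₀ T) (fun x => (level d p x.2 : ℝ≥0∞)) ≤
      expectedTotalCost d p W ρ hρ φ j₀ (T + 1) := by
  simp only [expectedTotalCost_eq, expect_law_succ, ← expect_add, expect_const]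
  refine expect_mono _ fun x => ?_
  conv_lhs => rw [← expect_const (φ x.1 x.2) (_ + _)]
  refine expect_mono _ fun a => ?_
  rw [historyCost_cons, ← ENNReal.coe_add, ENNReal.coe_le_coe, add_comm]
  gcongr
  exact le_self_add

/-- If a potential `h` satisfies the average-cost optimality inequality with gain `g`, then the
total cost plus the potential grows by at least `g` per step, under every policy. -/
theorem le_expectedTotalCost_add (d p W ρ : ℝ≥0) (hρ : ρ ≤ 1) (g : ℝ≥0) (h : ℕ → ℝ≥0)
    (hdrift : ∀ j a, (g : ℝ≥0∞) + h j ≤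
      cost d p W j a + expect (transition ρ hρ j a) fun j' => (h j' : ℝ≥0∞))
    (φ : Policy) (j₀ T : ℕ) :
    (T : ℝ≥0∞) * g + h j₀ ≤ expectedTotalCost d p W ρ hρ φ j₀ T +
      expect (law ρ hρ φ j₀ T) (fun x => (h x.2 : ℝ≥0∞)) := by
  rw [expectedTotalCost_eq, ← expect_add]
  induction T with
  | zero => simp [law, expect_pure]
  | succ T ih =>
    calc ((T + 1 : ℕ) : ℝ≥0∞) * g + h j₀ = ((T : ℝ≥0∞) * g + h j₀) + g := by push_cast; ring
      _ ≤ _ := add_le_add_left ih _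
      _ = expect (law ρ hρ φ j₀ T) fun x => (historyCost d p W x.1 : ℝ≥0∞) + h x.2 + g := by
        rw [expect_add _ _ (fun _ => (g : ℝ≥0∞)), expect_const]
      _ ≤ _ := by
        rw [expect_law_succ]
        refine expect_mono _ fun x => ?_
        rw [← expect_const (φ x.1 x.2) (_ + _ + _)]
        refine expect_mono _ fun a => ?_
        simp only [historyCost_cons, expect_add, expect_const]
        calc (historyCost d p W x.1 : ℝ≥0∞) + h x.2 + g
            = historyCost d p W x.1 + (g + h x.2) := by ring
          _ ≤ historyCost d p W x.1 + (cost d p W x.2 a +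
              expect (transition ρ hρ x.2 a) fun j' => (h j' : ℝ≥0∞)) :=
            add_le_add_right (hdrift _ _) _
          _ = _ := by push_cast; ring

theorem expectedTotalCost_stationary_le (d p W ρ : ℝ≥0) (hρ : ρ ≤ 1) (g : ℝ≥0) (h : ℕ → ℝ≥0)
    (f : ℕ → Bool)
    (hdrift : ∀ j, (cost d p W j (f j) : ℝ≥0∞) +
      expect (transition ρ hρ j (f j)) (fun j' => (h j' : ℝ≥0∞)) ≤ g + h j) (j₀ T : ℕ) :
    expectedTotalCost d p W ρ hρ (stationary f) j₀ T ≤ (T : ℝ≥0∞) * g + h j₀ := by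
  suffices H : expect (law ρ hρ (stationary f) j₀ T)
      (fun x => (historyCost d p W x.1 : ℝ≥0∞) + h x.2) ≤ (T : ℝ≥0∞) * g + h j₀ by
    refine le_trans ?_ H
    exact expect_mono _ fun x => le_self_add
  induction T with
  | zero => simp [law, expect_pure, historyCost]
  | succ T ih =>
    calc _ ≤ expect (law ρ hρ (stationary f) j₀ T)
          fun x => (historyCost d p W x.1 : ℝ≥0∞) + h x.2 + g := by
          rw [expect_law_succ]
          refine expect_mono _ fun x => ?_
          simp only [stationary, expect_pure, historyCost_cons, expect_add, expect_const]
          calc _ = historyCost d p W x.1 + (cost d p W x.2 (f x.2) +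
              expect (transition ρ hρ x.2 (f x.2)) fun j' => (h j' : ℝ≥0∞)) := by
                push_cast; ring
            _ ≤ historyCost d p W x.1 + (g + h x.2) := add_le_add_right (hdrift _) _
            _ = _ := by ring
      _ = expect (law ρ hρ (stationary f) j₀ T)
          (fun x => (historyCost d p W x.1 : ℝ≥0∞) + h x.2) + g := by
          rw [expect_add _ _ (fun _ => (g : ℝ≥0∞)), expect_const]
      _ ≤ ((T : ℝ≥0∞) * g + h j₀) + g := add_le_add_left ih _
      _ = _ := by push_cast; ring

/-- If the increments of `C` dominate `L` and `g T ≤ C T + K (1 + L T)`, then `C T / T` is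
asymptotically at least `g` along a subsequence: otherwise `C` would grow superlinearly. -/
theorem le_limsup_div_of_increments (g K : ℝ≥0) (C L : ℕ → ℝ≥0∞)
    (hL : ∀ T, C T + L T ≤ C (T + 1))
    (hg : ∀ T : ℕ, (T : ℝ≥0∞) * g ≤ C T + K * (1 + L T)) :
    (g : ℝ≥0∞) ≤ Filter.limsup (fun T : ℕ => C T / (T : ℝ≥0∞)) Filter.atTop := by
  by_contra! hlt
  obtain ⟨r, hr1, hr2⟩ := ENNReal.lt_iff_exists_nnreal_btwn.1 hlt
  rw [ENNReal.coe_lt_coe] at hr2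
  obtain ⟨N, hN⟩ := Filter.eventually_atTop.1 (Filter.eventually_lt_of_limsup_lt hr1)
  have hCle : ∀ T, N + 1 ≤ T → C T ≤ ((r * T : ℝ≥0) : ℝ≥0∞) := by
    intro T hT
    have h0 : (T : ℝ≥0∞) ≠ 0 := by
      rw [Nat.cast_ne_zero]; omega
    have := (ENNReal.div_le_iff h0 (ENNReal.natCast_ne_top T)).1 (hN T (by omega)).le
    simpa using this
  have hfin : ∀ T, N + 1 ≤ T → C T ≠ ⊤ := fun T hT =>
    ne_top_of_le_ne_top ENNReal.coe_ne_top (hCle T hT)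
  set c : ℕ → ℝ := fun T => (C T).toReal with hc
  have hcr : ∀ T, N + 1 ≤ T → c T ≤ r * T := by
    intro T hT
    have := ENNReal.toReal_mono ENNReal.coe_ne_top (hCle T hT)
    simpa using this
  have hinc : ∀ T, N + 1 ≤ T → (T : ℝ) * g ≤ c T + K * (1 + (c (T + 1) - c T)) := by
    intro T hT
    have hLT : L T ≠ ⊤ := ne_top_of_le_ne_top (hfin (T + 1) (by omega))
      (le_trans le_add_self (hL T))
    have h1 := ENNReal.toReal_mono (hfin (T + 1) (by omega)) (hL T)
    rw [ENNReal.toReal_add (hfin T hT) hLT] at h1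
    have h2 := ENNReal.toReal_mono (by
      exact ENNReal.add_ne_top.2 ⟨hfin T hT, ENNReal.mul_ne_top ENNReal.coe_ne_top
        (ENNReal.add_ne_top.2 ⟨ENNReal.one_ne_top, hLT⟩)⟩) (hg T)
    rw [ENNReal.toReal_add (hfin T hT) (ENNReal.mul_ne_top ENNReal.coe_ne_top
        (ENNReal.add_ne_top.2 ⟨ENNReal.one_ne_top, hLT⟩)), ENNReal.toReal_mul,
        ENNReal.toReal_mul, ENNReal.toReal_add ENNReal.one_ne_top hLT] at h2
    simp only [ENNReal.toReal_natCast, ENNReal.coe_toReal, ENNReal.toReal_one] at h2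
    have hK : (0 : ℝ) ≤ K := K.2
    have : (K : ℝ) * (1 + (L T).toReal) ≤ K * (1 + (c (T + 1) - c T)) := by
      gcongr
      simp only [hc]; linarith
    simp only [hc] at this ⊢
    linarith
  have hδ : (0 : ℝ) < g - r := sub_pos.2 (by exact_mod_cast hr2)
  obtain ⟨M, hM⟩ := exists_nat_ge ((K + K * r + 1) / ((g : ℝ) - r))
  rw [div_le_iff₀ hδ] at hM
  set T₁ := max (N + 1) M with hT₁
  -- By the choice of `M`, `T (g - r)` exceeds `K + K r + 1`. Multiplying by `K` rather than
  -- dividing also covers `K = 0`.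
  have hstep : ∀ T, T₁ ≤ T → (K : ℝ) * (c T - r * T) + 1 ≤ K * (c (T + 1) - r * (T + 1)) := by
    intro T hT
    have h1 := hinc T (le_trans (le_max_left _ _) hT)
    have h2 := hcr T (le_trans (le_max_left _ _) hT)
    have h3 : (M : ℝ) ≤ T := by exact_mod_cast le_trans (le_max_right _ _) hT
    have h4 := mul_le_mul_of_nonneg_right h3 hδ.le
    nlinarith
  have hlin : ∀ k : ℕ, (K : ℝ) * (c T₁ - r * T₁) + k ≤
      K * (c (T₁ + k) - r * ((T₁ + k : ℕ) : ℝ)) := by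
    intro k
    induction k with
    | zero => simp
    | succ k ih =>
      have := hstep (T₁ + k) (by omega)
      rw [← add_assoc]
      push_cast at ih this ⊢
      linarith
  obtain ⟨k, hk⟩ := exists_nat_gt (-((K : ℝ) * (c T₁ - r * T₁)))
  have h1 := hlin k
  have h2 := hcr (T₁ + k) (le_trans (le_max_left _ _) (Nat.le_add_right _ _))
  have h3 : (K : ℝ) * (c (T₁ + k) - r * ((T₁ + k : ℕ) : ℝ)) ≤ 0 :=
    mul_nonpos_of_nonneg_of_nonpos K.2 (by linarith)
  linarith

/-- Verification, lower bound: an optimality inequality whose potential grows at most like the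
level bounds the average cost of every policy from below. -/
theorem le_averageCost (d p W ρ : ℝ≥0) (hρ : ρ ≤ 1) (g K : ℝ≥0) (h : ℕ → ℝ≥0)
    (hK : ∀ j, h j ≤ K * (1 + level d p j))
    (hdrift : ∀ j a, (g : ℝ≥0∞) + h j ≤
      cost d p W j a + expect (transition ρ hρ j a) fun j' => (h j' : ℝ≥0∞))
    (φ : Policy) (j₀ : ℕ) :
    (g : ℝ≥0∞) ≤ averageCost d p W ρ hρ φ j₀ := by
  refine le_limsup_div_of_increments g K _
    (fun T => expect (law ρ hρ φ j₀ T) fun x => (level d p x.2 : ℝ≥0∞))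
    (expectedTotalCost_add_level_le d p W ρ hρ φ j₀) fun T => ?_
  refine le_trans (le_trans le_self_add
    (le_expectedTotalCost_add d p W ρ hρ g h hdrift φ j₀ T)) (add_le_add_right ?_ _)
  rw [← expect_const (law ρ hρ φ j₀ T) 1, ← expect_add, ← expect_const_mul]
  refine expect_mono _ fun x => ?_
  exact_mod_cast hK x.2

/-- Verification, upper bound. -/
theorem averageCost_stationary_le (d p W ρ : ℝ≥0) (hρ : ρ ≤ 1) (g : ℝ≥0) (h : ℕ → ℝ≥0)
    (f : ℕ → Bool)
    (hdrift : ∀ j, (cost d p W j (f j) : ℝ≥0∞) +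
      expect (transition ρ hρ j (f j)) (fun j' => (h j' : ℝ≥0∞)) ≤ g + h j) (j₀ : ℕ) :
    averageCost d p W ρ hρ (stationary f) j₀ ≤ g := by
  have hlim : Filter.Tendsto (fun T : ℕ => (g : ℝ≥0∞) + h j₀ / T) Filter.atTop
      (nhds ((g : ℝ≥0∞) + 0)) :=
    tendsto_const_nhds.add (ENNReal.Tendsto.const_div ENNReal.tendsto_nat_nhds_top
      (Or.inr ENNReal.coe_ne_top) |>.trans (by simp))
  rw [add_zero] at hlim
  rw [← hlim.limsup_eq]
  refine Filter.limsup_le_limsup (Filter.eventually_atTop.2 ⟨1, fun T hT => ?_⟩)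
  have h0 : (T : ℝ≥0∞) ≠ 0 := by
    rw [Nat.cast_ne_zero]; omega
  refine le_trans (ENNReal.div_le_div_right
    (expectedTotalCost_stationary_le d p W ρ hρ g h f hdrift j₀ T) _) (le_of_eq ?_)
  rw [ENNReal.add_div, mul_comm, ENNReal.mul_div_cancel_right h0 (ENNReal.natCast_ne_top T)]

/-! ### Explicit solution of the optimality equation -/

/-- The solution `B` of `B j = b j + (1 - ρ) B (j + 1)` for `b j = β j (j + 1) / 2`: the expected
total level until the first success when always active. -/
def activeValue (β ρ : ℝ) (j : ℕ) : ℝ :=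
  β * ((j : ℝ) * (j + 1) / 2 / ρ + (1 - ρ) * (j + 1) / ρ ^ 2 + (1 - ρ) ^ 2 / ρ ^ 3)

theorem activeValue_eq (β ρ : ℝ) (hρ : 0 < ρ) (j : ℕ) :
    activeValue β ρ j = β * (j * (j + 1)) / 2 + (1 - ρ) * activeValue β ρ (j + 1) := by
  unfold activeValue
  push_cast
  field_simp
  ring

theorem activeValue_mono (β ρ : ℝ) (hβ : 0 ≤ β) (hρ : 0 < ρ) (hρ1 : ρ ≤ 1) :
    Monotone (activeValue β ρ) := by
  intro i j hij
  have h1 : (0 : ℝ) ≤ 1 - ρ := by linarith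
  have h2 : (i : ℝ) ≤ j := by exact_mod_cast hij
  unfold activeValue
  gcongr

theorem level_le_mul_activeValue (β ρ : ℝ) (hβ : 0 ≤ β) (hρ : 0 < ρ) (hρ1 : ρ ≤ 1) (j : ℕ) :
    β * (j * (j + 1)) / 2 ≤ ρ * activeValue β ρ j := by
  have h1 : (0 : ℝ) ≤ 1 - ρ := by linarith
  have h2 : ρ * activeValue β ρ j = β * (j * (j + 1)) / 2 +
      β * ((1 - ρ) * (j + 1) / ρ + (1 - ρ) ^ 2 / ρ ^ 2) := by
    unfold activeValue
    field_simp
    ring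
  rw [h2]
  have : 0 ≤ β * ((1 - ρ) * (j + 1) / ρ + (1 - ρ) ^ 2 / ρ ^ 2) := by positivity
  linarith

theorem activeValue_le (β ρ : ℝ) (hβ : 0 ≤ β) (hρ : 0 < ρ) (hρ1 : ρ ≤ 1) :
    ∃ K, 0 ≤ K ∧ ∀ j : ℕ, activeValue β ρ j ≤ K * (1 + β * (j * (j + 1)) / 2) := by
  have h1 : (0 : ℝ) ≤ 1 - ρ := by linarith
  refine ⟨1 / ρ + (1 - ρ) / ρ ^ 2 + β * ((1 - ρ) / ρ ^ 2 + (1 - ρ) ^ 2 / ρ ^ 3),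
    by positivity, fun j => ?_⟩
  -- Integrality of `j` lets the quadratic term absorb the linear one.
  have hj : (j : ℝ) ≤ j * (j + 1) / 2 := by
    rcases Nat.eq_zero_or_pos j with rfl | h
    · simp
    · have : (1 : ℝ) ≤ j := by exact_mod_cast h
      nlinarith
  set t : ℝ := j * (j + 1) / 2 with ht
  have ht0 : 0 ≤ t := by positivity
  have e1 : activeValue β ρ j = β * (t / ρ + (1 - ρ) / ρ ^ 2 * (j + 1)
      + (1 - ρ) ^ 2 / ρ ^ 3) := by
    unfold activeValue; rw [← ht]; ring
  have e2 : β * ((j : ℝ) * (j + 1)) / 2 = β * t := by rw [ht]; ring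
  rw [e1, e2]
  set u := (1 - ρ) / ρ ^ 2
  set v := (1 - ρ) ^ 2 / ρ ^ 3
  have hu : 0 ≤ u := by positivity
  have hv : 0 ≤ v := by positivity
  have h3 : 0 ≤ β * (u + v) * (β * t) := by positivity
  have h4 : β * u * j ≤ β * u * t := by gcongr
  have h5 : 0 ≤ 1 / ρ := by positivity
  have e3 : t / ρ = 1 / ρ * t := by ring
  rw [e3]
  nlinarith

/-- The threshold at which the marginal benefit of waiting changes sign. -/
theorem exists_threshold (β W ρ : ℝ) (hβ : 0 < β) (hW : 0 ≤ W) (hρ : 0 < ρ) (hρ1 : ρ ≤ 1) :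
    ∃ n : ℕ,
      ρ * n * activeValue β ρ n ≤ (∑ i ∈ Finset.range n, β * ((i : ℝ) * (i + 1)) / 2) + W / ρ ∧
      (∑ i ∈ Finset.range (n + 1), β * ((i : ℝ) * (i + 1)) / 2) + W / ρ ≤
        ρ * (n + 1 : ℕ) * activeValue β ρ (n + 1) := by
  set F : ℕ → ℝ := fun n => (∑ i ∈ Finset.range n, β * ((i : ℝ) * (i + 1)) / 2) + W / ρ -
    ρ * n * activeValue β ρ n with hF
  -- The decrement is at least `b (n + 1) - b n = β (n + 1)`.
  have hstep : ∀ n, F (n + 1) ≤ F n - β := by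
    intro n
    have h1 := level_le_mul_activeValue β ρ hβ.le hρ hρ1 (n + 1)
    have h2 : ρ * n * activeValue β ρ n ≤ ρ * n * activeValue β ρ (n + 1) := by
      gcongr
      exact activeValue_mono β ρ hβ.le hρ hρ1 (Nat.le_succ n)
    simp only [hF, Finset.sum_range_succ]
    push_cast at h1 ⊢
    have h3 : 0 ≤ β * n := by positivity
    nlinarith
  have hlin : ∀ n : ℕ, F n ≤ F 0 - n * β := by
    intro n
    induction n with
    | zero => simp
    | succ n ih =>
      have := hstep n
      push_cast
      linarith
  have hex : ∃ n, F (n + 1) ≤ 0 := by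
    obtain ⟨n, hn⟩ := exists_nat_ge (F 0 / β)
    rw [div_le_iff₀ hβ] at hn
    refine ⟨n, ?_⟩
    have := hlin (n + 1)
    push_cast at this
    linarith
  classical
  refine ⟨Nat.find hex, ?_, by simpa [hF] using Nat.find_spec hex⟩
  suffices 0 ≤ F (Nat.find hex) from sub_nonneg.1 this
  rcases h : Nat.find hex with _ | m
  · simp only [hF, Finset.range_zero, Finset.sum_empty, Nat.cast_zero]
    have : 0 ≤ W / ρ := by positivity
    linarith
  · exact (not_le.1 (Nat.find_min hex (m := m) (by omega))).le

/-- The average-cost optimality equation has a nonnegative solution of at most quadratic growth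
whose minimizing actions form a threshold rule. -/
theorem exists_bellman (β W ρ : ℝ) (hβ : 0 < β) (hW : 0 ≤ W) (hρ : 0 < ρ) (hρ1 : ρ ≤ 1) :
    ∃ (n : ℕ) (g K : ℝ) (h : ℕ → ℝ), 0 ≤ g ∧ 0 ≤ K ∧ (∀ j, 0 ≤ h j) ∧
      (∀ j : ℕ, h j ≤ K * (1 + β * (j * (j + 1)) / 2)) ∧
      (∀ j : ℕ, g + h j ≤ β * (j * (j + 1)) / 2 + h (j + 1)) ∧
      (∀ j : ℕ, g + h j ≤ β * (j * (j + 1)) / 2 + W + (ρ * h 0 + (1 - ρ) * h (j + 1))) ∧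
      (∀ j : ℕ, j < n → g + h j = β * (j * (j + 1)) / 2 + h (j + 1)) ∧
      (∀ j : ℕ, n ≤ j →
        g + h j = β * (j * (j + 1)) / 2 + W + (ρ * h 0 + (1 - ρ) * h (j + 1))) := by
  obtain ⟨n, hn1, hn2⟩ := exists_threshold β W ρ hβ hW hρ hρ1
  set B := activeValue β ρ with hB
  set b : ℕ → ℝ := fun j => β * ((j : ℝ) * (j + 1)) / 2 with hb
  set S : ℕ → ℝ := fun n => ∑ i ∈ Finset.range n, b i with hS
  have hBeq : ∀ j, B j = b j + (1 - ρ) * B (j + 1) := activeValue_eq β ρ hρ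
  have hBmono : Monotone B := activeValue_mono β ρ hβ.le hρ hρ1
  have hbB : ∀ j, b j ≤ ρ * B j := level_le_mul_activeValue β ρ hβ.le hρ hρ1
  have hb0 : ∀ j, 0 ≤ b j := fun j => by simp only [hb]; positivity
  have hbmono : Monotone b := by
    intro i j hij
    have : (i : ℝ) ≤ j := by exact_mod_cast hij
    simp only [hb]
    gcongr
  change ρ * n * B n ≤ S n + W / ρ at hn1
  change S (n + 1) + W / ρ ≤ ρ * (n + 1 : ℕ) * B (n + 1) at hn2
  have hSs : ∀ j, S (j + 1) = S j + b j := fun j => Finset.sum_range_succ _ _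
  have hpos : (0 : ℝ) < n + 1 / ρ := by positivity
  -- The unique gain for which the two formulas for `h` agree at `n`; the threshold inequalities
  -- become `ρ B n ≤ g ≤ ρ B (n + 1)`.
  set g := (S n + B n + W / ρ) / (n + 1 / ρ) with hg
  have hgeq : g * (n + 1 / ρ) = S n + B n + W / ρ := div_mul_cancel₀ _ hpos.ne'
  have hg1 : ρ * B n ≤ g := by
    rw [hg, le_div_iff₀ hpos]
    have : ρ * B n * (n + 1 / ρ) = ρ * n * B n + B n := by field_simp
    linarith
  have hg2 : g ≤ ρ * B (n + 1) := by
    rw [hg, div_le_iff₀ hpos]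
    have : ρ * B (n + 1) * (n + 1 / ρ) = ρ * n * B (n + 1) + B (n + 1) := by field_simp
    have h1 := hBeq n
    have h2 := hSs n
    push_cast at hn2
    linarith
  have hgb : ∀ j, j ≤ n → b j ≤ g := fun j hj => (hbmono hj).trans ((hbB n).trans hg1)
  have hg0 : 0 ≤ g := (hb0 n).trans (hgb n le_rfl)
  set h : ℕ → ℝ := fun j => if j ≤ n then j * g - S j else B j + (W - g) / ρ with hh
  have hle : ∀ j, j ≤ n → h j = j * g - S j := fun j hj => if_pos hj
  have hge : ∀ j, n ≤ j → h j = B j + (W - g) / ρ := by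
    intro j hj
    rcases hj.eq_or_lt with rfl | hj
    · rw [hle _ le_rfl]
      have : g * (n + 1 / ρ) = n * g + g / ρ := by ring
      rw [sub_div]
      linarith
    · exact if_neg (by omega)
  have hh0 : h 0 = 0 := by rw [hle 0 (Nat.zero_le _)]; simp [hS]
  have hlt : ∀ j, j < n → g + h j = b j + h (j + 1) := by
    intro j hj
    rw [hle j hj.le, hle (j + 1) hj, hSs]
    push_cast
    ring
  have hact : ∀ j, n ≤ j → g + h j = b j + W + (ρ * h 0 + (1 - ρ) * h (j + 1)) := by
    intro j hj
    rw [hge j hj, hge (j + 1) (by omega), hh0, hBeq j]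
    field_simp
    ring
  have hmono : Monotone h := by
    refine monotone_nat_of_le_succ fun j => ?_
    rcases lt_or_ge j n with hj | hj
    · have := hlt j hj
      have := hgb j hj.le
      linarith
    · rw [hge j hj, hge (j + 1) (by omega)]
      have := hBmono (Nat.le_succ j)
      linarith
  -- As `h 0 = 0`, being active in `j` is no worse exactly when `W ≤ ρ h (j + 1)`.
  have hhn : ρ * h n ≤ W := by
    rw [hge n le_rfl, mul_add, mul_div_cancel₀ _ hρ.ne']
    linarith
  have hhn1 : W ≤ ρ * h (n + 1) := by
    rw [hge (n + 1) (by omega), mul_add, mul_div_cancel₀ _ hρ.ne']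
    linarith
  have hhpos : ∀ j, 0 ≤ h j := fun j => hh0 ▸ hmono (Nat.zero_le j)
  obtain ⟨K, hK0, hK⟩ := activeValue_le β ρ hβ.le hρ hρ1
  have hB0 : ∀ j, 0 ≤ B j := fun j => by
    have := (hb0 j).trans (hbB j)
    exact nonneg_of_mul_nonneg_right this hρ
  refine ⟨n, g, K + h n + |(W - g) / ρ|, h, hg0, ?_, hhpos, ?_, ?_, ?_, hlt, hact⟩
  · have := hhpos n
    positivity
  · intro j
    have h1 : B j ≤ K * (1 + b j) := hK j
    have h2 := hhpos n
    have h3 : 0 ≤ (h n + |(W - g) / ρ|) * b j := mul_nonneg (by positivity) (hb0 j)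
    have h4 : h j ≤ B j + h n + |(W - g) / ρ| := by
      rcases le_total j n with hj | hj
      · have := hmono hj
        have := hB0 j
        have := abs_nonneg ((W - g) / ρ)
        linarith
      · rw [hge j hj]
        have := le_abs_self ((W - g) / ρ)
        linarith
    change h j ≤ (K + h n + |(W - g) / ρ|) * (1 + b j)
    linarith
  · intro j
    change g + h j ≤ b j + h (j + 1)
    rcases lt_or_ge j n with hj | hj
    · exact (hlt j hj).le
    · rw [hact j hj, hh0]
      have : ρ * h (n + 1) ≤ ρ * h (j + 1) :=
        mul_le_mul_of_nonneg_left (hmono (by omega)) hρ.le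
      linarith
  · intro j
    change g + h j ≤ b j + W + (ρ * h 0 + (1 - ρ) * h (j + 1))
    rcases lt_or_ge j n with hj | hj
    · rw [hlt j hj, hh0]
      have : ρ * h (j + 1) ≤ ρ * h n := mul_le_mul_of_nonneg_left (hmono hj) hρ.le
      linarith
    · exact (hact j hj).le

theorem coe_level (d p : ℝ≥0) (j : ℕ) :
    (level d p j : ℝ) = (d * p : ℝ) * (j * (j + 1)) / 2 := by
  simp [level]

theorem level_strictMono {d p : ℝ≥0} (hd : 0 < d) (hp : 0 < p) : StrictMono (level d p) := by
  intro i j hij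
  rw [← NNReal.coe_lt_coe, coe_level, coe_level]
  have h1 : (i : ℝ) < j := by exact_mod_cast hij
  have h2 : (0 : ℝ) < d * p := by positivity
  gcongr

/-! ### The case of no success, and conclusion -/

/-- The index grows by one at each step, so the potential `g * j` satisfies the drift inequality for
every `g`. -/
theorem averageCost_eq_top_of_success_zero (d p W : ℝ≥0) (hd : 0 < d) (hp : 0 < p)
    (hρ : (0 : ℝ≥0) ≤ 1) (φ : Policy) (j₀ : ℕ) : averageCost d p W 0 hρ φ j₀ = ⊤ := by
  refine ENNReal.eq_top_of_forall_nnreal_le fun g => ?_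
  refine le_averageCost d p W 0 hρ g (g / (d * p)) (fun j => g * j) (fun j => ?_)
    (fun j a => ?_) φ j₀
  · rw [← NNReal.coe_le_coe]
    push_cast
    rw [coe_level]
    have hβ : (0 : ℝ) < d * p := by positivity
    have hj : (j : ℝ) ≤ j * (j + 1) / 2 := by
      rcases Nat.eq_zero_or_pos j with rfl | h
      · simp
      · have : (1 : ℝ) ≤ j := by exact_mod_cast h
        nlinarith
    have hq : (0 : ℝ) ≤ g / (d * p) := by positivity
    calc (g : ℝ) * j ≤ g * (j * (j + 1) / 2) := by gcongr
      _ = g / (d * p) * ((d * p) * (j * (j + 1)) / 2) := by field_simp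
      _ ≤ _ := by gcongr; linarith
  · have : expect (transition 0 hρ j a) (fun j' => ((g * j' : ℝ≥0) : ℝ≥0∞)) =
        ((g * (j + 1 : ℕ) : ℝ≥0) : ℝ≥0∞) := by
      cases a
      · rw [expect_transition_false]
      · rw [expect_transition_true]; simp
    rw [this]
    refine le_trans (le_of_eq ?_) le_add_self
    push_cast
    ring

end AoII

end

theorem theorem1 (d p ρ W : ℝ≥0) (hd : 0 < d) (hp : 0 < p) (hp1 : p ≤ 1) (hρ : ρ ≤ 1) :
    ∃ (n : ℕ) (f : ℕ → Bool),
      AoII.IsIncreasingThreshold d p n f ∧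
      AoII.IsOptimal d p W ρ hρ (AoII.stationary f) := by
  have hthr : ∀ n : ℕ, AoII.IsIncreasingThreshold d p n fun j => decide (n ≤ j) := by
    intro n
    have hmono := AoII.level_strictMono hd hp
    exact ⟨fun j hj => by simpa using hmono.lt_iff_lt.1 hj,
      fun j hj => by simpa using hmono.le_iff_le.1 hj⟩
  rcases eq_zero_or_pos ρ with rfl | hρ0
  -- Any threshold would do here.
  · refine ⟨0, _, hthr 0, fun j₀ ψ => ?_⟩
    rw [AoII.averageCost_eq_top_of_success_zero d p W hd hp hρ ψ]
    exact le_top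
  obtain ⟨n, g, K, h, hg, hK, hh, hhK, hpas, hact, hpas_eq, hact_eq⟩ :=
    AoII.exists_bellman (d * p : ℝ) W ρ (by positivity) W.2 hρ0 (by exact_mod_cast hρ)
  lift g to ℝ≥0 using hg
  lift K to ℝ≥0 using hK
  lift h to ℕ → ℝ≥0 using hh
  simp only [← AoII.coe_level] at hhK hpas hact hpas_eq hact_eq
  have hsub : ((1 - ρ : ℝ≥0) : ℝ) = 1 - ρ := by push_cast [hρ]; rfl
  simp only [← hsub] at hact hact_eq
  have hstep : ∀ j a, (AoII.cost d p W j a : ℝ≥0∞) +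
      AoII.expect (AoII.transition ρ hρ j a) (fun j' => (h j' : ℝ≥0∞)) =
      ((if a then AoII.level d p j + W + (ρ * h 0 + (1 - ρ) * h (j + 1))
        else AoII.level d p j + h (j + 1) : ℝ≥0) : ℝ≥0∞) := by
    intro j a
    cases a
    · simp [AoII.expect_transition_false, AoII.cost, AoII.actionValue]
    · rw [AoII.expect_transition_true]
      simp [AoII.cost, AoII.actionValue]
  refine ⟨n, _, hthr n, fun j₀ ψ => ?_⟩
  refine le_trans (AoII.averageCost_stationary_le d p W ρ hρ g h _ (fun j => ?_) j₀)
    (AoII.le_averageCost d p W ρ hρ g K h (fun j => ?_) (fun j a => ?_) ψ j₀)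
  · rw [hstep, ← ENNReal.coe_add, ENNReal.coe_le_coe]
    by_cases hj : n ≤ j
    · simp only [hj, decide_true, if_true]
      exact_mod_cast (hact_eq j hj).ge
    · simp only [hj, decide_false, Bool.false_eq_true, if_false]
      exact_mod_cast (hpas_eq j (not_le.1 hj)).ge
  · exact_mod_cast hhK j
  · rw [hstep, ← ENNReal.coe_add, ENNReal.coe_le_coe]
    cases a
    · simp only [Bool.false_eq_true, if_false]
      exact_mod_cast hpas j
    · simp only [if_true]
      exact_mod_cast hact j
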